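/- \textbf{Setting.} There are $n\ge 1$ players and two channels; time is slotted, $t=1,2,\dots$. Initially all players are pending. In each round every pending player either transmits on one of the two channels or stays silent; a pending player who is the only one transmitting on her channel is successful and stops being pending, and colliding transmissions fail. With \emph{ternary feedback}, every pending player is told before each round the number $m$ of pending players. A \emph{protocol} assigns to each round $t$, to the current number $m$ of pending players, and to what the player has seen in rounds $1,\dots,t-1$ (her own actions and the announced numbers of pending players) a probability distribution on $\{\text{silent},1,2\}$; the players randomize independently. A protocol is \emph{anonymous} when it is used by all players. Let $T_i$ be the round in which player $i$ is successful ($\infty$ if there is none). For a profile of protocols and a transmission history $h_t$ of all players during the first $t$ rounds, let $C_i(h_t)=\mathbb E[T_i\mid h_t]\in[0,\infty]$ be the expected latency of a pending player $i$ when the profile is used from round $t+1$ on, and let $F_i(h_t)=C_i(h_t)-t$ be her expected future latency. A profile is an \emph{equilibrium} if for every history $h_t$, every player $i$ pending after $h_t$, and every protocol of $i$, player $i$ does not decrease $C_i(h_t)$ by switching to that protocol after $h_t$. Write $F_i(h_t;a)$ for the expected future latency of $i$ when she surely takes action $a$ in round $t+1$, all others follow their protocols in that round, and all players follow their protocols afterwards.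 \textbf{Theorem.} Let $n\ge1$. (1) In the class of (possibly history-dependent) protocols with ternary feedback for $n$ players and two channels there exists an anonymous equilibrium protocol with finite expected latency $C_i(h_t)<\infty$ after every history. It can be chosen such that its decision rule depends only on the round, the current number of pending players and the player's own past actions, and such that, whenever at least two players are pending, it assigns the same transmission probability to each of the two channels. (2) Let $f$ be any anonymous equilibrium protocol with ternary feedback (such as the one in (1)), and let $h_t$ be a history after which $m\ge 2$ players are pending, $i$ among them. If $f$ prescribes to $i$ in round $t+1$ the same transmission probability $p$ ($=p_{m,t+1}$) on each of the two channels, then $0<p\le\frac12$, and for each channel $c\in\{1,2\}$ $$F_i(h_t)=F_i(h_t;c)\le F_i(h_t;\text{silent}),$$ with $F_i(h_t;c)=F_i(h_t;\text{silent})$ whenever $p<\frac12$, that is, whenever staying silent has positive probability. -/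

import Mathlib

open scoped ENNReal

noncomputable section

namespace Contention

/-- The actions of a player in a round with `k` channels: `some c` means transmitting on channel
`c`, and `none` means not transmitting. -/
abbrev Action (k : ℕ) := Option (Fin k)

/-- A transmission vector: the actions of all `n` players in one round.  The entries of players
that are no longer pending are irrelevant. -/
abbrev Profile (n k : ℕ) := Fin n → Action k

/-- A transmission history of all players, most recent round first. The length of the list is the
number `t` of rounds that have been played. Every such list is a possible history. -/
abbrev History (n k : ℕ) := List (Profile n k)

/-- Player `i`, one of the players in the set `P` of pending players, transmits successfully:
she is the only pending player that transmits on her channel. -/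
def Succeeds {n k : ℕ} (P : Finset (Fin n)) (a : Profile n k) (i : Fin n) : Prop :=
  i ∈ P ∧ ∃ c : Fin k, a i = some c ∧ ∀ j ∈ P, j ≠ i → a j ≠ some c

open Classical in
/-- The set of players that are pending after the history `h`. -/
def pending {n k : ℕ} : History n k → Finset (Fin n)
  | [] => Finset.univ
  | a :: h => (pending h).filter fun i => ¬ Succeeds (pending h) a i

/-- What player `i` has seen during the history `h` (most recent round first): for each past round,
the number of players that were pending right before that round, and her own action in it. -/
def observation {n k : ℕ} (i : Fin n) : History n k → List (ℕ × Action k)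
  | [] => []
  | a :: h => ((pending h).card, a i) :: observation i h

/-- A transmission protocol with ternary feedback. The decision rule for round `t` maps the number
of players that are pending right before round `t`, and what the player has seen in the
rounds `1, …, t - 1`, to a mixed strategy, that is, a probability distribution on the actions. The
round `t` is determined by the length of the list. -/
abbrev Protocol (k : ℕ) := ℕ → List (ℕ × Action k) → PMF (Action k)

/-- The decision rules of the protocol depend only on the round, on the number of players that are
pending right before it, and on the personal transmission history (the own past actions). -/
def Protocol.DependsOnCountAndPersonalHistory {k : ℕ} (f : Protocol k) : Prop :=
  ∀ (m : ℕ) (o o' : List (ℕ × Action k)), o.map Prod.snd = o'.map Prod.snd → f m o = f m o'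

/-- A protocol for two channels puts equal probability on the two channels whenever at least two
players are pending. -/
def Protocol.SplitsEqually (f : Protocol 2) : Prop :=
  ∀ (m : ℕ) (o : List (ℕ × Action 2)), 2 ≤ m → f m o (some 0) = f m o (some 1)

/-- A protocol profile: one protocol per player. -/
abbrev ProtocolProfile (n k : ℕ) := Fin n → Protocol k

/-- The profile in which all players use the common, anonymous protocol `f`. -/
def anonymous (n : ℕ) {k : ℕ} (f : Protocol k) : ProtocolProfile n k := fun _ => f

/-- The mixed strategy of player `i` in the round after the history `h`. Players that are not
pending do not transmit. -/
def strategy {n k : ℕ} (f : ProtocolProfile n k) (h : History n k) (i : Fin n) :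
    PMF (Action k) :=
  if i ∈ pending h then f i (pending h).card (observation i h) else PMF.pure none

/-- The probability of the transmission vector `a` when the players randomize independently with
the mixed strategies `σ`. -/
def jointProb {n k : ℕ} (σ : Fin n → PMF (Action k)) (a : Profile n k) : ℝ≥0∞ :=
  ∏ i, σ i (a i)

/-- The conditional probability, given the history `h` of the first `t` rounds and
that the profile `f` is used from round `t + 1` on, that player `i` transmits successfully
in round `t + s`, that is, `T_i = t + s`. (For `s = 0`: that she is no longer pending.) -/
def latencyProb {n k : ℕ} (f : ProtocolProfile n k) (i : Fin n) : ℕ → History n k → ℝ≥0∞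
  | 0, h => if i ∈ pending h then 0 else 1
  | s + 1, h =>
      if i ∈ pending h then
        ∑ a : Profile n k, jointProb (strategy f h) a * latencyProb f i s (a :: h)
      else 0

/-- The expected future latency `F_i(h) = E[T_i - t | h]`: the expectation of the waiting time,
which takes values in `{0, 1, 2, …} ∪ {∞}`, under its conditional law. It is zero for a
player that is no longer pending. -/
def futureLatency {n k : ℕ} (f : ProtocolProfile n k) (i : Fin n) (h : History n k) : ℝ≥0∞ :=
  (∑' s : ℕ, (s : ℝ≥0∞) * latencyProb f i s h) + ⊤ * (1 - ∑' s : ℕ, latencyProb f i s h)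

/-- The expected latency `C_i(h) = E[T_i | h]` of a pending player. -/
def expectedLatency {n k : ℕ} (f : ProtocolProfile n k) (i : Fin n) (h : History n k) : ℝ≥0∞ :=
  (h.length : ℝ≥0∞) + futureLatency f i h

/-- The expected future latency of player `i` after the history `h` if she surely
takes the action `a` in the next round, while the others follow `f` in it, and everyone follows
`f` in all later rounds. -/
def futureLatencyPlaying {n k : ℕ} (f : ProtocolProfile n k) (i : Fin n) (h : History n k)
    (a : Action k) : ℝ≥0∞ :=
  1 + ∑ b : Profile n k,
    jointProb (Function.update (strategy f h) i (PMF.pure a)) b * futureLatency f i (b :: h)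

/-- The protocol `g` is a best response of player `i` to the protocols of the other players in `f`:
after no transmission history can she, being pending, decrease her expected latency by using
another protocol from then on. -/
def IsBestResponse {n k : ℕ} (f : ProtocolProfile n k) (i : Fin n) (g : Protocol k) : Prop :=
  ∀ h : History n k, i ∈ pending h → ∀ g' : Protocol k,
    expectedLatency (Function.update f i g) i h ≤ expectedLatency (Function.update f i g') i h

/-- Every player's protocol is a best response to the protocols of the others. -/
def IsEquilibrium {n k : ℕ} (f : ProtocolProfile n k) : Prop :=
  ∀ i : Fin n, IsBestResponse f i (f i)

/-- After every history, every pending player has finite expected latency. -/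
def HasFiniteLatency {n k : ℕ} (f : ProtocolProfile n k) : Prop :=
  ∀ (h : History n k) (i : Fin n), i ∈ pending h → expectedLatency f i h < ⊤

end Contention

end

/-!
For the indifference conditions, a player may play any action `a` in one round and follow the
protocol afterwards, because the length of her observation tells her the round. In an equilibrium
hence `F ≤ F(a)` for every `a`, while `F` is the average of the `F(a)`; so `F = F(a)` for every `a`
of positive probability (`IsEquilibrium.futureLatency_eq_playing`). It remains to see that a player
who treats both channels alike cannot be silent for sure. Her observation is compatible with a
history in which the same number of players is pending and all of them have made that same
observation (`homogenize`): the players who stay pending copy her past actions. These are at least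
two, so the copied transmissions collide, and they do not disturb the successful players. After
that history everybody would be silent, and each player would gain by transmitting.

An equilibrium exists already among the memoryless protocols that transmit with a probability
`p m ≤ 1 / 2` on each channel when `m` players are pending. By symmetry the costs of the actions
depend only on `m` (`continuation_equivariant`), and `p m` is found by induction on `m` from the
intermediate value theorem (`exists_isBalanced`): transmitting is optimal, and silence is so too
unless it has probability zero. The resulting costs are bounded and satisfy the one-step optimality
equations, which bounds the latency of every deviation from below
(`le_futureLatency_of_le_step`) and that of the protocol itself from above
(`futureLatency_le_of_step_le`). Both bounds use that the expected latency is the sum of the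
survival probabilities (`futureLatency_eq_tsum_survivalProb`).
-/

open scoped ENNReal

noncomputable section

namespace Contention

open Finset

/-! ### Expected latency as a sum of survival probabilities -/

/-- The expectation of a waiting time with point probabilities `L s` and tail probabilities `r s`
is the sum of the tails; the mass missing from `L` sits at infinity. -/
theorem expectation_eq_tsum_tail {L r : ℕ → ℝ≥0∞} (h0 : L 0 + r 0 = 1)
    (hs : ∀ s, L (s + 1) + r (s + 1) = r s) :
    (∑' s : ℕ, (s : ℝ≥0∞) * L s) + ⊤ * (1 - ∑' s : ℕ, L s) = ∑' s, r s := by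
  have hmass : ∀ N, ∑ s ∈ range (N + 1), L s + r N = 1 := by
    intro N
    induction N with
    | zero => simpa using h0
    | succ N ih => rw [sum_range_succ, add_assoc, hs, ih]
  -- Summation by parts.
  have habel : ∀ N, ∑ s ∈ range (N + 1), (s : ℝ≥0∞) * L s + N * r N = ∑ s ∈ range N, r s := by
    intro N
    induction N with
    | zero => simp
    | succ N ih =>
      rw [sum_range_succ _ (N + 1), add_assoc, ← mul_add, hs, sum_range_succ r N, ← ih]
      push_cast
      ring
  have hle : ∑' s, L s ≤ 1 := by
    rw [ENNReal.tsum_eq_iSup_nat]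
    refine iSup_le fun N => ?_
    calc ∑ s ∈ range N, L s ≤ ∑ s ∈ range (N + 1), L s :=
          sum_le_sum_of_subset (range_mono N.le_succ)
      _ ≤ 1 := (hmass N) ▸ le_self_add
  apply le_antisymm
  · by_cases htop : ∑' s, r s = ⊤
    · rw [htop]; exact le_top
    have hr : Filter.Tendsto r Filter.atTop (nhds 0) := ENNReal.tendsto_atTop_zero_of_tsum_ne_top htop
    have hone : 1 ≤ ∑' s, L s := by
      have : Filter.Tendsto (fun N => (∑' s, L s) + r N) Filter.atTop (nhds ((∑' s, L s) + 0)) :=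
        hr.const_add _
      rw [add_zero] at this
      refine ge_of_tendsto' this fun N => ?_
      rw [← hmass N]
      gcongr
      exact ENNReal.sum_le_tsum _
    rw [tsub_eq_zero_of_le hone, mul_zero, add_zero, ENNReal.tsum_eq_iSup_nat]
    refine iSup_le fun N => ?_
    calc ∑ s ∈ range N, (s : ℝ≥0∞) * L s ≤ ∑ s ∈ range (N + 1), (s : ℝ≥0∞) * L s :=
          sum_le_sum_of_subset (range_mono N.le_succ)
      _ ≤ ∑ s ∈ range N, r s := (habel N) ▸ le_self_add
      _ ≤ _ := ENNReal.sum_le_tsum _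
  · rcases hle.lt_or_eq with hlt | heq
    · rw [ENNReal.top_mul (tsub_pos_of_lt hlt).ne', add_top]
      exact le_top
    rw [heq, tsub_self, mul_zero, add_zero, ENNReal.tsum_eq_iSup_nat]
    refine iSup_le fun N => ?_
    -- The boundary term `N * r N` is dominated by the part of the expectation beyond `N`.
    have htail : r N = ∑' k, L (k + (N + 1)) := by
      have h1 := ENNReal.summable.sum_add_tsum_nat_add' (k := N + 1) (f := L)
      rw [heq, ← hmass N] at h1
      refine ((ENNReal.add_right_inj ?_).1 h1).symm
      exact ne_top_of_le_ne_top ENNReal.one_ne_top ((hmass N) ▸ le_self_add)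
    have hsplit := ENNReal.summable.sum_add_tsum_nat_add' (k := N + 1)
      (f := fun s : ℕ => (s : ℝ≥0∞) * L s)
    rw [← habel N, htail, ← hsplit, ← ENNReal.tsum_mul_left]
    gcongr with k
    omega

theorem sum_jointProb {n k : ℕ} (σ : Fin n → PMF (Action k)) :
    ∑ a : Profile n k, jointProb σ a = 1 := by
  have h := Finset.prod_univ_sum (fun _ : Fin n => (univ : Finset (Action k)))
    (fun j a => σ j a)
  rw [Fintype.piFinset_univ] at h
  unfold jointProb
  rw [← h]
  refine prod_eq_one fun j _ => ?_
  rw [← tsum_fintype (L := .unconditional _), (σ j).tsum_coe]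

/-- Conditioning the joint law on the action of player `i`. -/
theorem jointProb_update {n k : ℕ} (σ : Fin n → PMF (Action k)) (i : Fin n) (τ : PMF (Action k))
    (b : Profile n k) :
    jointProb (Function.update σ i τ) b
      = ∑ a, τ a * jointProb (Function.update σ i (PMF.pure a)) b := by
  have key : ∀ ρ : PMF (Action k), jointProb (Function.update σ i ρ) b
      = ρ (b i) * ∏ j ∈ univ.erase i, σ j (b j) := by
    intro ρ
    unfold jointProb
    rw [← mul_prod_erase univ _ (mem_univ i), Function.update_self]
    congr 1
    refine prod_congr rfl fun j hj => ?_
    rw [Function.update_of_ne (ne_of_mem_erase hj)]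
  simp_rw [key, ← mul_assoc]
  rw [← sum_mul]
  congr 1
  simp [PMF.pure_apply]

theorem sum_jointProb_update_mul {n k : ℕ} (σ : Fin n → PMF (Action k)) (i : Fin n)
    (τ : PMF (Action k)) (φ : Profile n k → ℝ≥0∞) :
    ∑ b, jointProb (Function.update σ i τ) b * φ b
      = ∑ a, τ a * ∑ b, jointProb (Function.update σ i (PMF.pure a)) b * φ b := by
  simp_rw [jointProb_update σ i τ, sum_mul, mul_sum]
  rw [sum_comm]
  simp_rw [mul_assoc]

theorem sum_jointProb_pure_mul {n k : ℕ} (b₀ : Profile n k) (φ : Profile n k → ℝ≥0∞) :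
    ∑ b, jointProb (fun j => PMF.pure (b₀ j)) b * φ b = φ b₀ := by
  have : ∀ b, jointProb (fun j => PMF.pure (b₀ j)) b = if b = b₀ then 1 else 0 := by
    intro b
    unfold jointProb
    split_ifs with hb
    · simp [hb]
    · obtain ⟨j, hj⟩ := Function.ne_iff.1 hb
      exact prod_eq_zero (mem_univ j) (by simp [hj])
  simp [this]

theorem sum_pmf {k : ℕ} (τ : PMF (Action k)) : ∑ a, τ a = 1 := by
  rw [← tsum_fintype (L := .unconditional _), τ.tsum_coe]

/-- The probability that player `i` is still pending `s` rounds after the history `h`. -/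
def survivalProb {n k : ℕ} (f : ProtocolProfile n k) (i : Fin n) : ℕ → History n k → ℝ≥0∞
  | 0, h => if i ∈ pending h then 1 else 0
  | s + 1, h =>
      if i ∈ pending h then
        ∑ a : Profile n k, jointProb (strategy f h) a * survivalProb f i s (a :: h)
      else 0

section Latency

variable {n k : ℕ} (f : ProtocolProfile n k) (i : Fin n)

theorem latencyProb_add_survivalProb_zero (h : History n k) :
    latencyProb f i 0 h + survivalProb f i 0 h = 1 := by
  by_cases hi : i ∈ pending h <;> simp [latencyProb, survivalProb, hi]

theorem latencyProb_add_survivalProb_succ (s : ℕ) (h : History n k) :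
    latencyProb f i (s + 1) h + survivalProb f i (s + 1) h = survivalProb f i s h := by
  induction s generalizing h with
  | zero =>
    by_cases hi : i ∈ pending h
    · rw [latencyProb, survivalProb.eq_2, if_pos hi, if_pos hi, ← sum_add_distrib]
      simp_rw [← mul_add, latencyProb_add_survivalProb_zero, mul_one]
      rw [sum_jointProb, survivalProb, if_pos hi]
    · simp [latencyProb, survivalProb, hi]
  | succ s ih =>
    by_cases hi : i ∈ pending h
    · rw [latencyProb, survivalProb.eq_2, if_pos hi, if_pos hi, ← sum_add_distrib]
      simp_rw [← mul_add, ih]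
      rw [survivalProb, if_pos hi]
    · simp [latencyProb, survivalProb, hi]

theorem futureLatency_eq_tsum_survivalProb (h : History n k) :
    futureLatency f i h = ∑' s, survivalProb f i s h :=
  expectation_eq_tsum_tail (latencyProb_add_survivalProb_zero f i h)
    fun s => latencyProb_add_survivalProb_succ f i s h

variable {i}

theorem futureLatency_of_notMem {h : History n k} (hi : i ∉ pending h) :
    futureLatency f i h = 0 := by
  rw [futureLatency_eq_tsum_survivalProb, ENNReal.tsum_eq_zero]
  rintro (_ | s) <;> simp [survivalProb, hi]

theorem futureLatency_step {h : History n k} (hi : i ∈ pending h) :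
    futureLatency f i h
      = 1 + ∑ a, jointProb (strategy f h) a * futureLatency f i (a :: h) := by
  rw [futureLatency_eq_tsum_survivalProb, tsum_eq_zero_add' ENNReal.summable]
  simp only [survivalProb, if_pos hi, futureLatency_eq_tsum_survivalProb]
  rw [Summable.tsum_finsetSum fun _ _ => ENNReal.summable]
  simp_rw [ENNReal.tsum_mul_left]

theorem one_le_futureLatency {h : History n k} (hi : i ∈ pending h) :
    1 ≤ futureLatency f i h := by
  rw [futureLatency_step f hi]
  exact le_self_add

/-- The law of total expectation for the action of player `i` in the next round. -/
theorem futureLatency_eq_sum_playing {h : History n k} (hi : i ∈ pending h) :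
    futureLatency f i h = ∑ a, strategy f h i a * futureLatencyPlaying f i h a := by
  have key := sum_jointProb_update_mul (strategy f h) i (strategy f h i)
    (fun a => futureLatency f i (a :: h))
  rw [Function.update_eq_self] at key
  rw [futureLatency_step f hi, key]
  simp_rw [futureLatencyPlaying, mul_add, mul_one]
  rw [sum_add_distrib, sum_pmf]

end Latency

theorem length_observation {n k : ℕ} (i : Fin n) (h : History n k) :
    (observation i h).length = h.length := by
  induction h with
  | nil => rfl
  | cons a h ih => simp [observation, ih]

/-- The latency after `h` is determined by the strategies used from then on. -/
theorem futureLatency_congr {n k : ℕ} {f g : ProtocolProfile n k} (i : Fin n) {h : History n k}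
    (hfg : ∀ h' : History n k, h.length ≤ h'.length → strategy f h' = strategy g h') :
    futureLatency f i h = futureLatency g i h := by
  have key : ∀ s (h' : History n k), h.length ≤ h'.length →
      survivalProb f i s h' = survivalProb g i s h' := by
    intro s
    induction s with
    | zero => intro h' _; rfl
    | succ s ih =>
      intro h' hh
      simp only [survivalProb]
      rw [hfg h' hh]
      congr 1
      refine sum_congr rfl fun a _ => ?_
      rw [ih (a :: h') (by simp; omega)]
  simp_rw [futureLatency_eq_tsum_survivalProb]
  exact tsum_congr fun s => key s h le_rfl

theorem strategy_update {n k : ℕ} (f : ProtocolProfile n k) (i : Fin n) (g : Protocol k)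
    (h : History n k) :
    strategy (Function.update f i g) h
      = Function.update (strategy f h) i (strategy (Function.update f i g) h i) := by
  funext j
  by_cases hj : j = i
  · subst hj; simp
  · simp [strategy, Function.update_of_ne hj]

/-! ### Deviations in a single round -/

/-- Playing `a` in the next round and following `f` afterwards is itself available as a protocol,
since the length of the observation reveals the round. -/
theorem exists_protocol_futureLatency_eq_playing {n k : ℕ} (f : ProtocolProfile n k) {i : Fin n}
    {h : History n k} (hi : i ∈ pending h) (a : Action k) :
    ∃ g : Protocol k,
      futureLatency (Function.update f i g) i h = futureLatencyPlaying f i h a := by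
  refine ⟨fun m o => if o.length = h.length then PMF.pure a else f i m o, ?_⟩
  rw [futureLatency_step _ hi, strategy_update]
  have h1 : strategy (Function.update f i
      (fun m o => if o.length = h.length then PMF.pure a else f i m o)) h i = PMF.pure a := by
    simp [strategy, hi, length_observation]
  rw [h1, futureLatencyPlaying]
  congr 1
  refine sum_congr rfl fun b _ => ?_
  congr 1
  refine futureLatency_congr i fun h' hh => ?_
  funext j
  by_cases hj : j = i
  · subst hj
    have : h'.length ≠ h.length := by simp at hh; omega
    simp [strategy, length_observation, this]
  · simp [strategy, Function.update_of_ne hj]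

theorem isEquilibrium_iff {n k : ℕ} {f : ProtocolProfile n k} :
    IsEquilibrium f ↔ ∀ (i : Fin n) (h : History n k), i ∈ pending h → ∀ g : Protocol k,
      futureLatency f i h ≤ futureLatency (Function.update f i g) i h := by
  unfold IsEquilibrium IsBestResponse expectedLatency
  simp only [Function.update_eq_self]
  refine forall₄_congr fun i h _ g => ?_
  exact ENNReal.add_le_add_iff_left (ENNReal.natCast_ne_top _)

theorem IsEquilibrium.futureLatency_le_playing {n k : ℕ} {f : ProtocolProfile n k}
    (hf : IsEquilibrium f) {i : Fin n} {h : History n k} (hi : i ∈ pending h) (a : Action k) :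
    futureLatency f i h ≤ futureLatencyPlaying f i h a := by
  obtain ⟨g, hg⟩ := exists_protocol_futureLatency_eq_playing f hi a
  exact hg ▸ isEquilibrium_iff.1 hf i h hi g

/-- In an equilibrium every action that is played with positive probability is optimal: a
convex combination of values that are all at least `F` equals `F` only if those with positive
weight are equal to `F`. -/
theorem IsEquilibrium.futureLatency_eq_playing {n k : ℕ} {f : ProtocolProfile n k}
    (hf : IsEquilibrium f) {i : Fin n} {h : History n k} (hi : i ∈ pending h) {a : Action k}
    (ha : strategy f h i a ≠ 0) :
    futureLatency f i h = futureLatencyPlaying f i h a := by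
  have hle := fun a => hf.futureLatency_le_playing hi a
  by_contra hne
  -- The inequality `hlt` also makes `F` finite, without which the sums could not be compared.
  have hlt := lt_of_le_of_ne (hle a) hne
  have hsum : ∑ a, strategy f h i a * futureLatency f i h
      < ∑ a, strategy f h i a * futureLatencyPlaying f i h a := by
    rw [← add_sum_erase univ _ (mem_univ a), ← add_sum_erase univ _ (mem_univ a)]
    refine ENNReal.add_lt_add_of_lt_of_le ?_ ?_ ?_
    · rw [← sum_mul]
      refine ENNReal.mul_ne_top ?_ hlt.ne_top
      exact ENNReal.sum_ne_top.2 fun b _ => PMF.apply_ne_top _ _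
    · rw [mul_comm, mul_comm _ (futureLatencyPlaying f i h a)]
      exact ENNReal.mul_lt_mul_left ha (PMF.apply_ne_top _ _) hlt
    · exact sum_le_sum fun b _ => mul_le_mul_right (hle b) _
  rw [← futureLatency_eq_sum_playing f hi, ← sum_mul, sum_pmf, one_mul] at hsum
  exact lt_irrefl _ hsum

/-! ### Histories in which all pending players look alike -/

theorem mem_pending_cons {n k : ℕ} {a : Profile n k} {h : History n k} {j : Fin n} :
    j ∈ pending (a :: h) ↔ j ∈ pending h ∧ ¬ Succeeds (pending h) a j := by
  simp [pending]

theorem pending_cons_subset {n k : ℕ} (a : Profile n k) (h : History n k) :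
    pending (a :: h) ⊆ pending h :=
  fun _ hj => (mem_pending_cons.1 hj).1

open Classical in
/-- The history `h`, changed so that in every round the players who stay pending after that round
copy the action of player `i`. -/
def homogenize {n k : ℕ} (i : Fin n) : History n k → History n k
  | [] => []
  | a :: h => (fun j => if j ∈ pending (a :: h) then a i else a j) :: homogenize i h

/-- Homogenizing does not change who succeeds when: at least two players copy the action of `i`,
so these fail, and they avoid the channels of the successful players because `i` did. -/
theorem pending_homogenize {n k : ℕ} {i : Fin n} {h : History n k} (hi : i ∈ pending h)
    (h2 : 2 ≤ (pending h).card) : pending (homogenize i h) = pending h := by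
  induction h with
  | nil => rfl
  | cons a h ih =>
    have ih := ih (pending_cons_subset a h hi)
      (h2.trans (card_le_card (pending_cons_subset a h)))
    ext j
    rw [homogenize, mem_pending_cons, ih, mem_pending_cons (a := a)]
    refine and_congr_right fun hj => not_congr ⟨?_, ?_⟩
    · rintro ⟨-, c, hc, hother⟩
      beta_reduce at hc hother
      by_cases hjQ : j ∈ pending (a :: h)
      · obtain ⟨j', hj', hne⟩ := exists_mem_ne h2 j
        have := hother j' (pending_cons_subset a h hj') hne
        rw [if_pos hjQ] at hc
        rw [if_pos hj'] at this
        exact absurd hc this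
      · by_contra hs
        exact hjQ (mem_pending_cons.2 ⟨hj, hs⟩)
    · intro hs
      have hjQ : j ∉ pending (a :: h) := fun hjQ => (mem_pending_cons.1 hjQ).2 hs
      obtain ⟨-, c, hc, hother⟩ := hs
      refine ⟨hj, c, by beta_reduce; rwa [if_neg hjQ], fun l hl hlj => ?_⟩
      beta_reduce
      split_ifs with hlQ
      · exact hother i (pending_cons_subset a h hi) fun hij => hjQ (hij ▸ hi)
      · exact hother l hl hlj

theorem observation_homogenize {n k : ℕ} {i : Fin n} {h : History n k} (hi : i ∈ pending h)
    (h2 : 2 ≤ (pending h).card) {j : Fin n} (hj : j ∈ pending h) :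
    observation j (homogenize i h) = observation i h := by
  induction h with
  | nil => rfl
  | cons a h ih =>
    have hsub := pending_cons_subset a h
    have h2' := h2.trans (card_le_card hsub)
    rw [homogenize, observation, observation, pending_homogenize (hsub hi) h2',
      ih (hsub hi) h2' (hsub hj), if_pos hj]

theorem pending_cons_none {n k : ℕ} (h : History n k) :
    pending ((fun _ => none) :: h) = pending h := by
  ext j
  simp [mem_pending_cons, Succeeds]

/-- If all pending players are silent for sure, each of them gains by transmitting. -/
theorem IsEquilibrium.strategy_ne_pure_none {n k : ℕ} {f : ProtocolProfile n (k + 1)}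
    (hf : IsEquilibrium f) {i : Fin n} {h : History n (k + 1)} (hi : i ∈ pending h) :
    strategy f h ≠ fun _ => PMF.pure none := by
  intro hs
  have hlow : 2 ≤ futureLatency f i h := by
    rw [futureLatency_step f hi, hs,
      sum_jointProb_pure_mul (fun _ => none) (fun a => futureLatency f i (a :: h)),
      ← one_add_one_eq_two]
    gcongr
    exact one_le_futureLatency f (by rwa [pending_cons_none])
  have hup : futureLatencyPlaying f i h (some 0) = 1 := by
    have hupd : Function.update (fun _ : Fin n => PMF.pure (none : Action (k + 1))) i
        (PMF.pure (some 0))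
        = fun j => PMF.pure (Function.update (fun _ : Fin n => none) i (some 0) j) := by
      funext j
      by_cases hj : j = i
      · subst hj; simp
      · simp [Function.update_of_ne hj]
    rw [futureLatencyPlaying, hs, hupd, sum_jointProb_pure_mul _
      (fun a => futureLatency f i (a :: h)), futureLatency_of_notMem, add_zero]
    rw [mem_pending_cons, not_and_not_right]
    exact fun _ => ⟨hi, 0, by simp, fun j _ hj => by simp [Function.update_of_ne hj]⟩
  have := hlow.trans (hf.futureLatency_le_playing hi (some 0))
  rw [hup] at this
  norm_num at this

theorem pmf_none_add_some_add_some (τ : PMF (Action 2)) :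
    τ none + (τ (some 0) + τ (some 1)) = 1 := by
  rw [← sum_pmf τ, Fintype.sum_option, Fin.sum_univ_two]

/-- A silent player would be silent also after the homogenized history, where all pending players
have made the observation of `i` and are therefore silent with her. -/
theorem IsEquilibrium.anonymous_ne_zero {n : ℕ} {f : Protocol 2}
    (hf : IsEquilibrium (anonymous n f)) {h : History n 2} {i : Fin n} (hi : i ∈ pending h)
    (h2 : 2 ≤ (pending h).card)
    (hp : f (pending h).card (observation i h) (some 0)
      = f (pending h).card (observation i h) (some 1)) :
    f (pending h).card (observation i h) (some 0) ≠ 0 := by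
  intro h0
  have hpure : f (pending h).card (observation i h) = PMF.pure none := by
    have h1 := pmf_none_add_some_add_some (f (pending h).card (observation i h))
    rw [← hp, h0, add_zero, add_zero] at h1
    ext a
    match a with
    | none => simpa using h1
    | some 0 => simpa using h0
    | some 1 => simpa [← hp] using h0
  refine hf.strategy_ne_pure_none (h := homogenize i h) (i := i)
    (by rwa [pending_homogenize hi h2]) ?_
  funext j
  rw [strategy, pending_homogenize hi h2]
  split_ifs with hj
  · rw [observation_homogenize hi h2 hj, anonymous, hpure]
  · rfl

/-- Indifference conditions for an equilibrium player who treats both channels alike. -/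
theorem IsEquilibrium.indifference {n : ℕ} {f : Protocol 2}
    (hf : IsEquilibrium (anonymous n f)) {h : History n 2} {i : Fin n} (hi : i ∈ pending h)
    (h2 : 2 ≤ (pending h).card) {p : ℝ≥0∞}
    (hp0 : f (pending h).card (observation i h) (some 0) = p)
    (hp1 : f (pending h).card (observation i h) (some 1) = p) :
    0 < p ∧ p ≤ 1 / 2 ∧ ∀ c : Fin 2,
      futureLatency (anonymous n f) i h = futureLatencyPlaying (anonymous n f) i h (some c) ∧
      futureLatencyPlaying (anonymous n f) i h (some c)
        ≤ futureLatencyPlaying (anonymous n f) i h none ∧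
      (p < 1 / 2 → futureLatencyPlaying (anonymous n f) i h (some c)
        = futureLatencyPlaying (anonymous n f) i h none) := by
  have hpne : p ≠ 0 := hp0 ▸ hf.anonymous_ne_zero hi h2 (hp0.trans hp1.symm)
  have hsum := pmf_none_add_some_add_some (f (pending h).card (observation i h))
  rw [hp0, hp1, ← two_mul] at hsum
  have hs : strategy (anonymous n f) h i = f (pending h).card (observation i h) := by
    simp [strategy, hi, anonymous]
  have hc : ∀ c : Fin 2,
      futureLatency (anonymous n f) i h
        = futureLatencyPlaying (anonymous n f) i h (some c) := by
    intro c
    refine hf.futureLatency_eq_playing hi ?_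
    rw [hs]
    match c with
    | 0 => rwa [hp0]
    | 1 => rwa [hp1]
  refine ⟨pos_iff_ne_zero.2 hpne, ?_, fun c => ⟨hc c, ?_, fun hlt => ?_⟩⟩
  · rw [ENNReal.le_div_iff_mul_le (Or.inl two_ne_zero) (Or.inl ENNReal.ofNat_ne_top), mul_comm,
      ← hsum]
    exact le_add_self
  · rw [← hc c]
    exact hf.futureLatency_le_playing hi none
  · rw [← hc c]
    refine hf.futureLatency_eq_playing hi ?_
    rw [hs]
    intro h0
    rw [h0, zero_add] at hsum
    rw [ENNReal.lt_div_iff_mul_lt (Or.inl two_ne_zero) (Or.inl ENNReal.ofNat_ne_top), mul_comm,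
      hsum] at hlt
    exact lt_irrefl _ hlt

/-! ### Verification by one-step inequalities -/

/-- A bounded function that satisfies the one-step inequality from below is a lower bound of the
expected latency: iterating it `N` times gives `u ≤ ∑ s < N, r s + B * r N` with the survival
probabilities `r`, and `r N → 0` when the latency is finite. -/
theorem le_futureLatency_of_le_step {n k : ℕ} (f : ProtocolProfile n k) (i : Fin n)
    {u : History n k → ℝ≥0∞} {B : ℝ≥0∞} (hB : B ≠ ⊤) (huB : ∀ h, u h ≤ B)
    (hu0 : ∀ h, i ∉ pending h → u h = 0)
    (hu : ∀ h, i ∈ pending h → u h ≤ 1 + ∑ a, jointProb (strategy f h) a * u (a :: h))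
    (h : History n k) : u h ≤ futureLatency f i h := by
  by_cases htop : futureLatency f i h = ⊤
  · rw [htop]; exact le_top
  have hiter : ∀ N h, u h ≤ ∑ s ∈ range N, survivalProb f i s h + B * survivalProb f i N h := by
    intro N
    induction N with
    | zero =>
      intro h
      by_cases hi : i ∈ pending h
      · simpa [survivalProb, hi] using huB h
      · simp [hu0 h hi]
    | succ N ih =>
      intro h
      by_cases hi : i ∈ pending h
      · refine (hu h hi).trans ?_
        rw [sum_range_succ', add_comm _ (survivalProb f i 0 h), add_assoc]
        simp only [survivalProb, if_pos hi]
        gcongr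
        rw [sum_comm, mul_sum, ← sum_add_distrib]
        refine sum_le_sum fun a _ => ?_
        rw [← mul_sum, mul_left_comm, ← mul_add]
        gcongr
        exact ih _
      · simp [hu0 h hi]
  rw [futureLatency_eq_tsum_survivalProb] at htop ⊢
  have hr := ENNReal.tendsto_atTop_zero_of_tsum_ne_top htop
  have hlim : Filter.Tendsto
      (fun N => (∑' s, survivalProb f i s h) + B * survivalProb f i N h) Filter.atTop
      (nhds ((∑' s, survivalProb f i s h) + B * 0)) :=
    (ENNReal.Tendsto.const_mul hr (Or.inr hB)).const_add _
  rw [mul_zero, add_zero] at hlim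
  refine ge_of_tendsto' hlim fun N => (hiter N h).trans ?_
  gcongr
  exact ENNReal.sum_le_tsum _

theorem futureLatency_le_of_step_le {n k : ℕ} (f : ProtocolProfile n k) (i : Fin n)
    {u : History n k → ℝ≥0∞}
    (hu : ∀ h, i ∈ pending h → 1 + ∑ a, jointProb (strategy f h) a * u (a :: h) ≤ u h)
    (h : History n k) : futureLatency f i h ≤ u h := by
  have hiter : ∀ N h, ∑ s ∈ range N, survivalProb f i s h ≤ u h := by
    intro N
    induction N with
    | zero => simp
    | succ N ih =>
      intro h
      by_cases hi : i ∈ pending h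
      · refine le_trans ?_ (hu h hi)
        rw [sum_range_succ', add_comm _ (survivalProb f i 0 h)]
        simp only [survivalProb, if_pos hi]
        gcongr
        rw [sum_comm]
        refine sum_le_sum fun a _ => ?_
        rw [← mul_sum]
        gcongr
        exact ih _
      · refine le_of_eq_of_le (sum_eq_zero fun s _ => ?_) zero_le
        cases s <;> simp [survivalProb, hi]
  rw [futureLatency_eq_tsum_survivalProb, ENNReal.tsum_eq_iSup_nat]
  exact iSup_le fun N => hiter N h

/-! ### One round against opponents who split equally -/

/-- Transmit with probability `p` on each of the two channels. -/
def splitWeight (p : ℝ) : Action 2 → ℝ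
  | none => 1 - 2 * p
  | some _ => p

theorem splitWeight_nonneg {p : ℝ} (hp : p ∈ Set.Icc (0 : ℝ) (1 / 2)) (a : Action 2) :
    0 ≤ splitWeight p a := by
  obtain ⟨h0, h1⟩ := hp
  cases a <;> simp only [splitWeight] <;> linarith

theorem sum_splitWeight (p : ℝ) : ∑ a, splitWeight p a = 1 := by
  rw [Fintype.sum_option, Fin.sum_univ_two]
  simp only [splitWeight]
  ring

/-- The weight that player `j` puts on an action when the players in `P` are pending: player `i`
plays `a` for sure, the other pending players split, and all others are silent. -/
def playerWeight {n : ℕ} (P : Finset (Fin n)) (i : Fin n) (p : ℝ) (a : Action 2) (j : Fin n)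
    (x : Action 2) : ℝ :=
  if j = i then (if x = a then 1 else 0)
  else if j ∈ P then splitWeight p x else (if x = none then 1 else 0)

open Classical in
/-- The players in `P` who are still pending after a round with transmissions `b`. -/
def remaining {n k : ℕ} (P : Finset (Fin n)) (b : Profile n k) : Finset (Fin n) :=
  P.filter fun j => ¬ Succeeds P b j

/-- The expected cost of player `i ∈ P` from the next round on, if she plays `a`, the other players
in `P` transmit with probability `p` on each channel, and being pending together with `m - 1`
others costs `V m`. -/
def continuation {n : ℕ} (P : Finset (Fin n)) (i : Fin n) (p : ℝ) (a : Action 2) (V : ℕ → ℝ) : ℝ :=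
  ∑ b : Profile n 2, (∏ j, playerWeight P i p a j (b j)) *
    (if i ∈ remaining P b then V (remaining P b).card else 0)

section Continuation

variable {n : ℕ} {P : Finset (Fin n)} {i : Fin n} {p : ℝ} {a : Action 2}

theorem mem_remaining {k : ℕ} {b : Profile n k} {j : Fin n} :
    j ∈ remaining P b ↔ j ∈ P ∧ ¬ Succeeds P b j := by
  simp [remaining]

theorem remaining_subset {k : ℕ} (P : Finset (Fin n)) (b : Profile n k) : remaining P b ⊆ P :=
  fun _ hj => (mem_remaining.1 hj).1

theorem pending_cons {k : ℕ} (b : Profile n k) (h : History n k) :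
    pending (b :: h) = remaining (pending h) b := rfl

theorem playerWeight_nonneg (hp : p ∈ Set.Icc (0 : ℝ) (1 / 2)) (j : Fin n) (x : Action 2) :
    0 ≤ playerWeight P i p a j x := by
  unfold playerWeight
  split_ifs
  any_goals positivity
  exact splitWeight_nonneg hp x

theorem prod_playerWeight_nonneg (hp : p ∈ Set.Icc (0 : ℝ) (1 / 2)) (b : Profile n 2) :
    0 ≤ ∏ j, playerWeight P i p a j (b j) :=
  prod_nonneg fun j _ => playerWeight_nonneg hp j (b j)

theorem sum_prod_playerWeight : ∑ b : Profile n 2, ∏ j, playerWeight P i p a j (b j) = 1 := by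
  have h := Finset.prod_univ_sum (fun _ : Fin n => (univ : Finset (Action 2)))
    (fun j x => playerWeight P i p a j x)
  rw [Fintype.piFinset_univ] at h
  rw [← h]
  refine prod_eq_one fun j _ => ?_
  unfold playerWeight
  split_ifs
  · simp
  · exact sum_splitWeight p
  · simp

theorem continuation_nonneg (hp : p ∈ Set.Icc (0 : ℝ) (1 / 2)) {V : ℕ → ℝ} (hV : ∀ m, 0 ≤ V m) :
    0 ≤ continuation P i p a V := by
  refine sum_nonneg fun b _ => mul_nonneg (prod_playerWeight_nonneg hp b) ?_
  split_ifs
  exacts [hV _, le_rfl]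

theorem continuation_congr {V V' : ℕ → ℝ} (hVV' : ∀ m ≤ P.card, V m = V' m) :
    continuation P i p a V = continuation P i p a V' := by
  unfold continuation
  refine sum_congr rfl fun b _ => ?_
  rw [hVV' _ (card_le_card (remaining_subset P b))]

theorem continuation_update (V : ℕ → ℝ) (m : ℕ) (x : ℝ) :
    continuation P i p a (Function.update V m x)
      = continuation P i p a (Function.update V m 0)
        + x * continuation P i p a (Pi.single m 1) := by
  unfold continuation
  rw [mul_sum, ← sum_add_distrib]
  refine sum_congr rfl fun b _ => ?_
  split_ifs
  · by_cases hm : (remaining P b).card = m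
    · simp [hm]; ring
    · simp [hm]
  · simp

theorem continuous_continuation (V : ℕ → ℝ) : Continuous fun p => continuation P i p a V := by
  have hw : ∀ x, Continuous fun p => splitWeight p x := by
    rintro (_ | c) <;> simp only [splitWeight] <;> fun_prop
  unfold continuation playerWeight
  refine continuous_finsetSum _ fun b _ => Continuous.mul ?_ continuous_const
  refine continuous_finsetProd _ fun j _ => ?_
  split_ifs
  any_goals exact continuous_const
  exact hw _

theorem succeeds_equivariant {k : ℕ} (π : Equiv.Perm (Fin n)) (τ : Equiv.Perm (Fin k))
    (b : Profile n k) (j : Fin n) :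
    Succeeds (P.map π.toEmbedding) (Equiv.arrowCongr π (Equiv.optionCongr τ) b) (π j)
      ↔ Succeeds P b j := by
  have hsome : ∀ (x : Action k) (c : Fin k), Option.map τ x = some (τ c) ↔ x = some c := by
    intro x c
    cases x <;> simp
  simp only [Succeeds, mem_map_equiv, Equiv.symm_apply_apply, Equiv.arrowCongr_apply,
    Function.comp_apply, Equiv.optionCongr_apply]
  rw [τ.surjective.exists]
  refine and_congr_right fun _ => exists_congr fun c => and_congr (hsome _ _) ?_
  rw [π.surjective.forall]
  simp [hsome]

theorem remaining_equivariant {k : ℕ} (π : Equiv.Perm (Fin n)) (τ : Equiv.Perm (Fin k))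
    (b : Profile n k) :
    remaining (P.map π.toEmbedding) (Equiv.arrowCongr π (Equiv.optionCongr τ) b)
      = (remaining P b).map π.toEmbedding := by
  ext j
  obtain ⟨j, rfl⟩ := π.surjective j
  simp only [mem_remaining, mem_map_equiv, Equiv.symm_apply_apply, succeeds_equivariant]

theorem playerWeight_equivariant (π : Equiv.Perm (Fin n)) (τ : Equiv.Perm (Fin 2)) (j : Fin n)
    (x : Action 2) :
    playerWeight (P.map π.toEmbedding) (π i) p (a.map τ) (π j) (x.map τ)
      = playerWeight P i p a j x := by
  have hw : splitWeight p (x.map τ) = splitWeight p x := by cases x <;> rfl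
  simp only [playerWeight, π.injective.eq_iff, (Option.map_injective τ.injective).eq_iff,
    mem_map_equiv, Equiv.symm_apply_apply, hw, Option.map_eq_none_iff]

/-- The continuation cost is invariant under renaming the players and the channels. -/
theorem continuation_equivariant (π : Equiv.Perm (Fin n)) (τ : Equiv.Perm (Fin 2))
    (V : ℕ → ℝ) :
    continuation (P.map π.toEmbedding) (π i) p (a.map τ) V = continuation P i p a V := by
  unfold continuation
  rw [← (Equiv.arrowCongr π (Equiv.optionCongr τ)).sum_comp]
  refine sum_congr rfl fun b _ => ?_
  simp only [remaining_equivariant, card_map, mem_map_equiv, Equiv.symm_apply_apply]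
  rw [← Equiv.prod_comp π]
  congr 1
  refine prod_congr rfl fun j _ => ?_
  rw [← playerWeight_equivariant (P := P) (i := i) (a := a) π τ j (b j)]
  simp

theorem exists_perm_map_eq {P' : Finset (Fin n)} {i' : Fin n} (hi : i ∈ P) (hi' : i' ∈ P')
    (hcard : P.card = P'.card) :
    ∃ π : Equiv.Perm (Fin n), P.map π.toEmbedding = P' ∧ π i = i' := by
  let e₀ : {j // j ∈ P} ≃ {j // j ∈ P'} := Finset.equivOfCardEq hcard
  let e := e₀.trans (Equiv.swap (e₀ ⟨i, hi⟩) ⟨i', hi'⟩)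
  refine ⟨e.extendSubtype, ?_, ?_⟩
  · refine eq_of_subset_of_card_le ?_ (by rw [card_map, hcard])
    intro j hj
    obtain ⟨l, hl, rfl⟩ := mem_map.1 hj
    exact e.extendSubtype_mem l hl
  · rw [e.extendSubtype_apply_of_mem i hi]
    simp [e]

theorem continuation_eq_of_card_eq {P' : Finset (Fin n)} {i' : Fin n} (hi : i ∈ P) (hi' : i' ∈ P')
    (hcard : P.card = P'.card) (V : ℕ → ℝ) :
    continuation P' i' p a V = continuation P i p a V := by
  obtain ⟨π, rfl, rfl⟩ := exists_perm_map_eq hi hi' hcard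
  simpa using continuation_equivariant (P := P) (i := i) (p := p) (a := a) π (Equiv.refl _) V

theorem continuation_some_eq (c c' : Fin 2) (V : ℕ → ℝ) :
    continuation P i p (some c) V = continuation P i p (some c') V := by
  have h := continuation_equivariant (P := P) (i := i) (p := p) (a := some c) (Equiv.refl _)
    (Equiv.swap c c') V
  rw [Option.map_some, Equiv.swap_apply_left] at h
  simpa using h.symm

/-- Transmitting succeeds with positive probability: the others may all be silent, or, if `p > 0`,
all use the other channel. -/
theorem continuation_some_single_lt_one (hi : i ∈ P) (hp : p ∈ Set.Icc (0 : ℝ) (1 / 2)) (m : ℕ) :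
    continuation P i p (some 0) (Pi.single m 1) < 1 := by
  refine lt_of_lt_of_eq ?_ (sum_prod_playerWeight (P := P) (i := i) (p := p) (a := some 0))
  have hval : ∀ b : Profile n 2,
      (if i ∈ remaining P b then (Pi.single m 1 : ℕ → ℝ) (remaining P b).card else 0) ≤ 1 := by
    intro b
    rw [Pi.single_apply]
    split_ifs <;> norm_num
  let b₀ : Profile n 2 := fun j =>
    if j = i then some 0 else if j ∈ P then (if p = 0 then none else some 1) else none
  refine sum_lt_sum (fun b _ => mul_le_of_le_one_right (prod_playerWeight_nonneg hp b) (hval b))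
    ⟨b₀, mem_univ _, ?_⟩
  have hsucc : i ∉ remaining P b₀ := by
    rw [mem_remaining, not_and_not_right]
    refine fun _ => ⟨hi, 0, by simp [b₀], fun j hj hji => ?_⟩
    simp only [b₀, if_neg hji, if_pos hj]
    split_ifs <;> simp
  rw [if_neg hsucc, mul_zero]
  refine prod_pos fun j _ => ?_
  by_cases hji : j = i
  · simp [playerWeight, b₀, hji]
  by_cases hj : j ∈ P
  · by_cases hp0 : p = 0
    · simp [playerWeight, b₀, hji, hj, hp0, splitWeight]
    · simpa [playerWeight, b₀, hji, hj, hp0, splitWeight] using lt_of_le_of_ne hp.1 (Ne.symm hp0)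
  · simp [playerWeight, b₀, hji, hj]

theorem one_le_continuation_none_single (hi : i ∈ P) :
    1 ≤ continuation P i 0 none (Pi.single P.card 1) := by
  have hrem : remaining P (fun _ => none : Profile n 2) = P := by
    ext j
    simp [mem_remaining, Succeeds]
  have hterm : (∏ j, playerWeight P i 0 none j ((fun _ => none : Profile n 2) j)) *
      (if i ∈ remaining P (fun _ => none : Profile n 2) then
        (Pi.single P.card 1 : ℕ → ℝ) (remaining P (fun _ => none : Profile n 2)).card else 0)
      = 1 := by
    rw [hrem, if_pos hi, Pi.single_eq_same, mul_one]
    refine prod_eq_one fun j _ => ?_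
    simp [playerWeight, splitWeight]
  refine hterm.symm.le.trans (single_le_sum (f := fun b : Profile n 2 => (∏ j, playerWeight P i 0 none j (b j)) *
      (if i ∈ remaining P b then (Pi.single P.card 1 : ℕ → ℝ) (remaining P b).card else 0))
    (fun b _ => mul_nonneg (prod_playerWeight_nonneg (by norm_num) b) ?_) (mem_univ _))
  rw [Pi.single_apply]
  split_ifs <;> norm_num

end Continuation

/-! ### Existence of balanced transmission probabilities -/

/-- With `m` pending players, costs `V` and transmission probability `p` per channel, the actions
in the support are optimal for every pending player, and `V m` is their common cost. -/
structure IsBalanced (n m : ℕ) (p : ℝ) (V : ℕ → ℝ) : Prop where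
  transmit : ∀ (P : Finset (Fin n)) (i : Fin n), i ∈ P → P.card = m → ∀ c : Fin 2,
    V m = 1 + continuation P i p (some c) V
  le_silent : ∀ (P : Finset (Fin n)) (i : Fin n), i ∈ P → P.card = m →
    V m ≤ 1 + continuation P i p none V
  silent : p < 1 / 2 → ∀ (P : Finset (Fin n)) (i : Fin n), i ∈ P → P.card = m →
    V m = 1 + continuation P i p none V

theorem IsBalanced.congr {n m : ℕ} {p : ℝ} {V V' : ℕ → ℝ} (h : IsBalanced n m p V)
    (hVV' : ∀ k ≤ m, V k = V' k) : IsBalanced n m p V' := by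
  have hc : ∀ (P : Finset (Fin n)) (i : Fin n) (a : Action 2), P.card = m →
      continuation P i p a V' = continuation P i p a V := fun P i a hP =>
    continuation_congr fun k hk => (hVV' k (hP ▸ hk)).symm
  refine ⟨fun P i hi hP c => ?_, fun P i hi hP => ?_, fun hp P i hi hP => ?_⟩
  · rw [hc P i _ hP, ← hVV' m le_rfl]; exact h.transmit P i hi hP c
  · rw [hc P i _ hP, ← hVV' m le_rfl]; exact h.le_silent P i hi hP
  · rw [hc P i _ hP, ← hVV' m le_rfl]; exact h.silent hp P i hi hP

/-- Given the costs with fewer players, a balanced probability for `m` players exists. For each `p`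
let `x p` be the cost of transmitting in every round, and `G p` the excess cost of staying silent
once. Then `G 0 ≥ 0`, and either `G (1 / 2) ≥ 0` or `G` has a zero in between. -/
theorem exists_isBalanced (n m : ℕ) {V : ℕ → ℝ} (hV : ∀ k, 0 ≤ V k) :
    ∃ p ∈ Set.Icc (0 : ℝ) (1 / 2), ∃ x, 0 ≤ x ∧ IsBalanced n m p (Function.update V m x) := by
  -- One pending set and player of the right size suffice, since all such pairs are equivalent; if
  -- there is none (`m = 0` or `m > n`), the conditions are void.
  by_cases hex : ∃ (P : Finset (Fin n)) (i : Fin n), i ∈ P ∧ P.card = m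
  swap
  · exact ⟨0, by norm_num, 0, le_rfl, fun P i hi hP => absurd ⟨P, i, hi, hP⟩ hex,
      fun P i hi hP => absurd ⟨P, i, hi, hP⟩ hex, fun _ P i hi hP => absurd ⟨P, i, hi, hP⟩ hex⟩
  obtain ⟨P, i, hi, hP⟩ := hex
  have hV0 : ∀ k, 0 ≤ Function.update V m 0 k := by
    intro k
    rw [Function.update_apply]
    split_ifs
    exacts [le_rfl, hV k]
  set A : Action 2 → ℝ → ℝ := fun a p => continuation P i p a (Function.update V m 0) with hA
  set Q : Action 2 → ℝ → ℝ := fun a p => continuation P i p a (Pi.single m 1) with hQ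
  have hAcont : ∀ a, Continuous (A a) := fun a => continuous_continuation _
  have hQcont : ∀ a, Continuous (Q a) := fun a => continuous_continuation _
  have hden : ∀ p ∈ Set.Icc (0 : ℝ) (1 / 2), 0 < 1 - Q (some 0) p := fun p hp =>
    sub_pos.2 (continuation_some_single_lt_one hi hp m)
  set x : ℝ → ℝ := fun p => (1 + A (some 0) p) / (1 - Q (some 0) p) with hx
  have hx0 : ∀ p ∈ Set.Icc (0 : ℝ) (1 / 2), 0 ≤ x p := fun p hp =>
    div_nonneg (add_nonneg zero_le_one (continuation_nonneg hp hV0)) (hden p hp).le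
  set G : ℝ → ℝ := fun p => 1 + A none p + x p * Q none p - x p with hG
  have hxcont : ContinuousOn x (Set.Icc 0 (1 / 2)) :=
    (continuous_const.add (hAcont _)).continuousOn.div
      (continuous_const.sub (hQcont _)).continuousOn fun p hp => (hden p hp).ne'
  have hGcont : ContinuousOn G (Set.Icc 0 (1 / 2)) :=
    ((continuous_const.add (hAcont _)).continuousOn.add
      (hxcont.mul (hQcont _).continuousOn)).sub hxcont
  have hzero : (0 : ℝ) ∈ Set.Icc (0 : ℝ) (1 / 2) := by norm_num
  have hG0 : 0 ≤ G 0 := by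
    -- For `p = 0` a silent player is sure to meet the same number of pending players again.
    have h1 : 1 ≤ Q none 0 := by
      rw [hQ, ← hP]
      exact one_le_continuation_none_single hi
    have h2 : 0 ≤ A none 0 := continuation_nonneg hzero hV0
    have h3 := mul_le_mul_of_nonneg_left h1 (hx0 0 hzero)
    simp only [hG]
    linarith
  obtain ⟨p, hp, hGp, hGp'⟩ :
      ∃ p ∈ Set.Icc (0 : ℝ) (1 / 2), 0 ≤ G p ∧ (p < 1 / 2 → G p = 0) := by
    by_cases hhalf : 0 ≤ G (1 / 2)
    · exact ⟨1 / 2, by norm_num, hhalf, fun h => absurd h (lt_irrefl _)⟩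
    · obtain ⟨p, hp, hGp⟩ := intermediate_value_Icc' (by norm_num) hGcont
        ⟨(not_le.1 hhalf).le, hG0⟩
      exact ⟨p, hp, hGp.ge, fun _ => hGp⟩
  have hc : ∀ (P' : Finset (Fin n)) (i' : Fin n) (a : Action 2), i' ∈ P' → P'.card = m →
      continuation P' i' p a (Function.update V m (x p)) = A a p + x p * Q a p :=
    fun P' i' a hi' hP' => by
      rw [continuation_eq_of_card_eq hi hi' (hP.trans hP'.symm), continuation_update]
  have hxp : x p = 1 + (A (some 0) p + x p * Q (some 0) p) := by
    have : x p * (1 - Q (some 0) p) = 1 + A (some 0) p := div_mul_cancel₀ _ (hden p hp).ne'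
    linarith
  refine ⟨p, hp, x p, hx0 p hp, fun P' i' hi' hP' c => ?_, fun P' i' hi' hP' => ?_,
    fun hlt P' i' hi' hP' => ?_⟩
  · rw [continuation_some_eq c 0, hc P' i' _ hi' hP', Function.update_self]
    exact hxp
  · rw [hc P' i' _ hi' hP', Function.update_self]
    simp only [hG] at hGp
    linarith
  · rw [hc P' i' _ hi' hP', Function.update_self]
    have := hGp' hlt
    simp only [hG] at this
    linarith

theorem exists_forall_lt_isBalanced (n N : ℕ) :
    ∃ (p : ℕ → Set.Icc (0 : ℝ) (1 / 2)) (V : ℕ → ℝ), (∀ m, 0 ≤ V m) ∧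
      ∀ m < N, IsBalanced n m (p m) V := by
  induction N with
  | zero => exact ⟨fun _ => ⟨0, by norm_num⟩, fun _ => 0, fun _ => le_rfl, by simp⟩
  | succ N ih =>
    obtain ⟨p, V, hV, hbal⟩ := ih
    obtain ⟨q, hq, x, hx, hqx⟩ := exists_isBalanced n N hV
    refine ⟨Function.update p N ⟨q, hq⟩, Function.update V N x, fun m => ?_, fun m hm => ?_⟩
    · rw [Function.update_apply]
      split_ifs
      exacts [hx, hV m]
    · rcases (Nat.lt_succ_iff.1 hm).lt_or_eq with hlt | rfl
      · rw [Function.update_of_ne hlt.ne]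
        exact (hbal m hlt).congr fun k hk =>
          (Function.update_of_ne (hk.trans_lt hlt).ne x V).symm
      · rwa [Function.update_self]

/-! ### The stationary equilibrium -/

/-- The mixed strategy that transmits with probability `p` on each of the two channels. -/
def splitPMF (p : Set.Icc (0 : ℝ) (1 / 2)) : PMF (Action 2) :=
  PMF.ofFintype (fun a => ENNReal.ofReal (splitWeight p a)) (by
    rw [← ENNReal.ofReal_sum_of_nonneg fun a _ => splitWeight_nonneg p.2 a, sum_splitWeight,
      ENNReal.ofReal_one])

/-- The memoryless protocol that, with `m` pending players, transmits with probability `p m` on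
each channel. -/
def stationary (p : ℕ → Set.Icc (0 : ℝ) (1 / 2)) : Protocol 2 := fun m _ => splitPMF (p m)

/-- The candidate for the expected future latency: `V m` for a player pending with `m - 1`
others, and zero for a player who is no longer pending. -/
def costToGo {n : ℕ} (V : ℕ → ℝ) (i : Fin n) (h : History n 2) : ℝ≥0∞ :=
  if i ∈ pending h then ENNReal.ofReal (V (pending h).card) else 0

section Stationary

variable {n : ℕ} {p : ℕ → Set.Icc (0 : ℝ) (1 / 2)} {V : ℕ → ℝ} {i : Fin n}

theorem jointProb_update_stationary {h : History n 2} (hi : i ∈ pending h) (a : Action 2)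
    (b : Profile n 2) :
    jointProb (Function.update (strategy (anonymous n (stationary p)) h) i (PMF.pure a)) b
      = ENNReal.ofReal (∏ j, playerWeight (pending h) i (p (pending h).card) a j (b j)) := by
  rw [ENNReal.ofReal_prod_of_nonneg fun j _ => playerWeight_nonneg (p _).2 j (b j)]
  refine prod_congr rfl fun j _ => ?_
  by_cases hji : j = i
  · subst hji
    by_cases hb : b j = a <;> simp [playerWeight, hb]
  · rw [Function.update_of_ne hji, playerWeight, if_neg hji]
    by_cases hj : j ∈ pending h
    · simp [strategy, hj, anonymous, stationary, splitPMF]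
    · by_cases hb : b j = none <;> simp [strategy, hj, hb]

theorem sum_jointProb_mul_costToGo (hV : ∀ m, 0 ≤ V m) {h : History n 2} (hi : i ∈ pending h)
    (a : Action 2) :
    ∑ b, jointProb (Function.update (strategy (anonymous n (stationary p)) h) i (PMF.pure a)) b
        * costToGo V i (b :: h)
      = ENNReal.ofReal (continuation (pending h) i (p (pending h).card) a V) := by
  unfold continuation
  rw [ENNReal.ofReal_sum_of_nonneg]
  · refine sum_congr rfl fun b _ => ?_
    rw [jointProb_update_stationary hi,
      ENNReal.ofReal_mul (prod_playerWeight_nonneg (p _).2 b)]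
    congr 1
    rw [costToGo]
    by_cases hib : i ∈ remaining (pending h) b
    · rw [if_pos hib, if_pos (by rwa [pending_cons]), pending_cons]
    · rw [if_neg hib, if_neg (by rwa [pending_cons]), ENNReal.ofReal_zero]
  · refine fun b _ => mul_nonneg (prod_playerWeight_nonneg (p _).2 b) ?_
    split_ifs
    exacts [hV _, le_rfl]

/-- Splitting the one-round cost of a mixed strategy `τ` of player `i` according to her action. -/
theorem one_add_sum_jointProb_mul_costToGo (hV : ∀ m, 0 ≤ V m) {h : History n 2}
    (hi : i ∈ pending h) (τ : PMF (Action 2)) :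
    1 + ∑ b, jointProb (Function.update (strategy (anonymous n (stationary p)) h) i τ) b
        * costToGo V i (b :: h)
      = ∑ a, τ a * ENNReal.ofReal (1 + continuation (pending h) i (p (pending h).card) a V) := by
  rw [sum_jointProb_update_mul]
  simp_rw [sum_jointProb_mul_costToGo hV hi]
  have : ∀ a, ENNReal.ofReal (1 + continuation (pending h) i (p (pending h).card) a V)
      = 1 + ENNReal.ofReal (continuation (pending h) i (p (pending h).card) a V) := fun a => by
    rw [ENNReal.ofReal_add zero_le_one (continuation_nonneg (p _).2 hV), ENNReal.ofReal_one]
  simp_rw [this, mul_add, mul_one]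
  rw [sum_add_distrib, sum_pmf]

theorem costToGo_le_futureLatency (hV : ∀ m, 0 ≤ V m)
    (hbal : ∀ m < n + 1, IsBalanced n m (p m) V) (g : Protocol 2) (h : History n 2) :
    costToGo V i h
      ≤ futureLatency (Function.update (anonymous n (stationary p)) i g) i h := by
  have hcard : ∀ h : History n 2, (pending h).card < n + 1 := fun h =>
    Nat.lt_succ_iff.2 (card_finset_fin_le _)
  refine le_futureLatency_of_le_step _ i (B := ENNReal.ofReal (∑ m ∈ range (n + 1), V m))
    ENNReal.ofReal_ne_top (fun h => ?_) (fun h hi => by simp [costToGo, hi]) (fun h hi => ?_) h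
  · unfold costToGo
    split_ifs
    · exact ENNReal.ofReal_le_ofReal
        (single_le_sum (fun m _ => hV m) (mem_range.2 (hcard h)))
    · exact zero_le
  · have hb := hbal _ (hcard h)
    rw [strategy_update, one_add_sum_jointProb_mul_costToGo hV hi, costToGo, if_pos hi]
    refine le_of_eq_of_le (b := ∑ a, strategy (Function.update (anonymous n (stationary p)) i g)
      h i a * ENNReal.ofReal (V (pending h).card)) (by rw [← sum_mul, sum_pmf, one_mul]) ?_
    gcongr with a
    cases a with
    | none => exact hb.le_silent _ i hi rfl
    | some c => exact (hb.transmit _ i hi rfl c).le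

theorem futureLatency_stationary_le_costToGo (hV : ∀ m, 0 ≤ V m)
    (hbal : ∀ m < n + 1, IsBalanced n m (p m) V) (h : History n 2) :
    futureLatency (anonymous n (stationary p)) i h ≤ costToGo V i h := by
  refine futureLatency_le_of_step_le _ i (fun h hi => ?_) h
  have hb := hbal (pending h).card (Nat.lt_succ_iff.2 (card_finset_fin_le _))
  have hs : strategy (anonymous n (stationary p)) h i = splitPMF (p (pending h).card) := by
    simp [strategy, hi, anonymous, stationary]
  have key := one_add_sum_jointProb_mul_costToGo (p := p) hV hi
    (strategy (anonymous n (stationary p)) h i)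
  rw [Function.update_eq_self] at key
  rw [key, hs, costToGo, if_pos hi]
  refine le_of_le_of_eq (b := ∑ a, splitPMF (p (pending h).card) a
    * ENNReal.ofReal (V (pending h).card)) (sum_le_sum fun a _ => ?_)
    (by rw [← sum_mul, sum_pmf, one_mul])
  cases a with
  | none =>
    -- Silence may be suboptimal only for `p = 1 / 2`, when it has probability zero.
    rcases (p (pending h).card).2.2.lt_or_eq with hlt | heq
    · rw [← hb.silent hlt _ i hi rfl]
    · have : splitPMF (p (pending h).card) none = 0 := by
        simp [splitPMF, splitWeight, heq]
      simp [this]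
  | some c => rw [← hb.transmit _ i hi rfl c]

end Stationary

theorem exists_stationary_equilibrium (n : ℕ) :
    ∃ p : ℕ → Set.Icc (0 : ℝ) (1 / 2), IsEquilibrium (anonymous n (stationary p)) ∧
      HasFiniteLatency (anonymous n (stationary p)) := by
  obtain ⟨p, V, hV, hbal⟩ := exists_forall_lt_isBalanced n (n + 1)
  refine ⟨p, isEquilibrium_iff.2 fun i h _ g =>
    (futureLatency_stationary_le_costToGo hV hbal h).trans
      (costToGo_le_futureLatency hV hbal g h), fun h i hi => ?_⟩
  refine ENNReal.add_lt_top.2 ⟨ENNReal.natCast_lt_top _,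
    (futureLatency_stationary_le_costToGo hV hbal h).trans_lt ?_⟩
  rw [costToGo, if_pos hi]
  exact ENNReal.ofReal_lt_top

end Contention

end

theorem mainTheorem10 (n : ℕ) (hn : 1 ≤ n) :
    (∃ f : Contention.Protocol 2,
      f.DependsOnCountAndPersonalHistory ∧
      Contention.IsEquilibrium (Contention.anonymous n f) ∧
      Contention.HasFiniteLatency (Contention.anonymous n f) ∧
      f.SplitsEqually) ∧
    (∀ f : Contention.Protocol 2, Contention.IsEquilibrium (Contention.anonymous n f) →
      ∀ (h : Contention.History n 2) (i : Fin n), i ∈ Contention.pending h →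
        2 ≤ (Contention.pending h).card →
        ∀ p : ENNReal,
          f (Contention.pending h).card (Contention.observation i h) (some 0) = p →
          f (Contention.pending h).card (Contention.observation i h) (some 1) = p →
          0 < p ∧ p ≤ 1 / 2 ∧
          (∀ c : Fin 2,
            Contention.futureLatency (Contention.anonymous n f) i h =
              Contention.futureLatencyPlaying (Contention.anonymous n f) i h (some c) ∧
            Contention.futureLatencyPlaying (Contention.anonymous n f) i h (some c) ≤
              Contention.futureLatencyPlaying (Contention.anonymous n f) i h none ∧
            (p < 1 / 2 →
              Contention.futureLatencyPlaying (Contention.anonymous n f) i h (some c) =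
                Contention.futureLatencyPlaying (Contention.anonymous n f) i h none))) := by
  refine ⟨?_, fun f hf h i hi h2 p hp0 hp1 => hf.indifference hi h2 hp0 hp1⟩
  obtain ⟨p, heq, hfin⟩ := Contention.exists_stationary_equilibrium n
  refine ⟨Contention.stationary p, fun m o o' _ => rfl, heq, hfin, fun m o _ => ?_⟩
  simp [Contention.stationary, Contention.splitPMF, Contention.splitWeight]
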